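/- Let $\sigma_\xi>0$ and $\rho\in(-1,0)$. Let $\mathbf Y=(Y_t)_{t\ge 0}$ be a real-valued Markov process on a probability space such that $Y_0=0$ and $Y_t=Y_{t-1}+\xi_t$ almost surely for $t\ge 1$, where each $\xi_t$ is Gaussian with mean zero and standard deviation $\sigma_\xi$, and where, for every $t\ge1$, the vector $(Y_{t-1},\xi_t)$ admits the Gaussian copula $C_\rho$ with parameter $\rho$ as a copula, that is, $$\mathbb P(Y_{t-1}\le x,\ \xi_t\le z)=C_\rho\big(\mathbb P(Y_{t-1}\le x),\,\mathbb P(\xi_t\le z)\big)\qquad\text{for all }x,z\in\mathbb R .$$ Here $C_\rho$ is the joint distribution function of $(\Phi(X_1),\Phi(X_2))$, where $(X_1,X_2)$ is bivariate normal with standard normal margins and correlation $\rho$, and $\Phi$ is the standard normal distribution function. Then $\mathbf Y$ is $\beta$-mixing (absolutely regular): the coefficients $$\beta_k=\sup_{t\ge 0}\ \sup_{\{A_i\},\{B_j\}}\ \frac12\sum_{i=1}^{I}\sum_{j=1}^{J}\big|\mathbb P(A_i\cap B_j)-\mathbb P(A_i)\mathbb P(B_j)\big|,$$ where the second supremum is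 over all finite partitions $\{A_1,\dots,A_I\}$ and $\{B_1,\dots,B_J\}$ of the sample space with $A_i\in\sigma(Y_s:\ s\le t)$ and $B_j\in\sigma(Y_s:\ s\ge t+k)$, satisfy $\beta_k\to0$ as $k\to\infty$. -/

import Mathlib

open MeasureTheory ProbabilityTheory Filter Topology
open scoped ENNReal

noncomputable section

namespace CopulaMarkov

/-- The law of a bivariate normal vector with standard normal margins and correlation `ρ`
(for `|ρ| ≤ 1`): the law of `(Z₁, ρ Z₁ + √(1 - ρ²) Z₂)` with `Z₁, Z₂` independent `N(0,1)`. -/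
def bivariateNormal (ρ : ℝ) : Measure (ℝ × ℝ) :=
  ((gaussianReal 0 1).prod (gaussianReal 0 1)).map
    (fun z => (z.1, ρ * z.1 + Real.sqrt (1 - ρ ^ 2) * z.2))

/-- The Gaussian copula with parameter `ρ`, that is, the joint distribution function of
`(Φ(X₁), Φ(X₂))`, where `(X₁, X₂)` is bivariate normal with standard normal margins and
correlation `ρ`, and `Φ` is the standard normal distribution function.
For `u, v ∈ (0,1)` this is `Φ_ρ(Φ⁻¹(u), Φ⁻¹(v))`, with `Φ_ρ` the distribution function of
`(X₁, X₂)`. -/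
def gaussianCopula (ρ u v : ℝ) : ℝ :=
  (bivariateNormal ρ).real
    {x | cdf (gaussianReal 0 1) x.1 ≤ u ∧ cdf (gaussianReal 0 1) x.2 ≤ v}

/-- `C` is a copula of the random vector `(X, Z)`: the joint distribution function of `(X, Z)` is
`C` applied to the marginal distribution functions. -/
def HasCopula {Ω : Type*} [MeasurableSpace Ω] (μ : Measure Ω) (X Z : Ω → ℝ)
    (C : ℝ → ℝ → ℝ) : Prop :=
  ∀ x z : ℝ, μ.real {ω | X ω ≤ x ∧ Z ω ≤ z} = C (μ.real {ω | X ω ≤ x}) (μ.real {ω | Z ω ≤ z})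

/-- The `σ`-field `σ(Y_s, s ∈ S)` generated by the variables with index in `S`. -/
abbrev sigmaField {Ω T : Type*} (Y : T → Ω → ℝ) (S : Set T) : MeasurableSpace Ω :=
  ⨆ s ∈ S, MeasurableSpace.comap (Y s) inferInstance

/-- The Markov property: for `s ≤ t`, the conditional probability of `Y_t ∈ A` given the past
`σ(Y_r, r ≤ s)` is the one given `σ(Y_s)`. -/
def IsMarkovProcess {Ω T : Type*} [MeasurableSpace Ω] [Preorder T]
    (μ : Measure Ω) (Y : T → Ω → ℝ) : Prop :=
  (∀ t, Measurable (Y t)) ∧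
  ∀ s t : T, s ≤ t → ∀ A : Set ℝ, MeasurableSet A →
    μ⟦Y t ⁻¹' A | sigmaField Y (Set.Iic s)⟧ =ᵐ[μ] μ⟦Y t ⁻¹' A | sigmaField Y {s}⟧

/-- A finite partition of `Ω` into sets of the `σ`-field `m` (empty parts are allowed; they do not
contribute to the sums below). -/
def IsFinitePartition {Ω : Type*} (m : MeasurableSpace Ω) {n : ℕ} (A : Fin n → Set Ω) : Prop :=
  (∀ i, MeasurableSet[m] (A i)) ∧ (∀ i j, i ≠ j → Disjoint (A i) (A j)) ∧ ⋃ i, A i = Set.univ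

/-- The coefficient of absolute regularity between two `σ`-fields: the supremum over finite
partitions `{A_i}` in `m₁` and `{B_j}` in `m₂` of `½ ∑ᵢ ∑ⱼ |P(A_i ∩ B_j) - P(A_i) P(B_j)|`. -/
def betaTilde {Ω : Type*} {m0 : MeasurableSpace Ω} (μ : Measure Ω) (m₁ m₂ : MeasurableSpace Ω) : ℝ≥0∞ :=
  ⨆ (I : ℕ) (J : ℕ) (A : Fin I → Set Ω) (B : Fin J → Set Ω)
    (_ : IsFinitePartition m₁ A) (_ : IsFinitePartition m₂ B),
    ENNReal.ofReal
      (1 / 2 * ∑ i, ∑ j, |μ.real (A i ∩ B j) - μ.real (A i) * μ.real (B j)|)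

/-- The dependence coefficient
`β_k = sup_t β̃(σ(Y_s, s ≤ t), σ(Y_s, s ≥ t + k))`. The time set `T` may be `ℤ` or `ℕ`. -/
def betaCoeff {Ω T : Type*} [MeasurableSpace Ω] [Preorder T] [AddMonoidWithOne T]
    (μ : Measure Ω) (Y : T → Ω → ℝ) (k : ℕ) : ℝ≥0∞ :=
  ⨆ t : T, betaTilde μ (sigmaField Y (Set.Iic t)) (sigmaField Y (Set.Ici (t + (k : T))))

/-- The process `Y` is `β`-mixing (absolutely regular): `β_k → 0` as `k → ∞`. -/
def IsBetaMixing {Ω T : Type*} [MeasurableSpace Ω] [Preorder T] [AddMonoidWithOne T]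
    (μ : Measure Ω) (Y : T → Ω → ℝ) : Prop :=
  Tendsto (fun k : ℕ => betaCoeff μ Y k) atTop (𝓝 0)

end CopulaMarkov

end

/-!
The process standardised to unit variance is a Gaussian Markov chain with correlations bounded away
from one, and such a chain forgets its past at a uniform rate.

By induction on `t`, the copula hypothesis makes `(Y_t, ξ_{t+1})`, for `t ≥ 1`, a bivariate normal
vector with correlation `ρ` (`map_prodMk_of_hasCopula`), so that `Y_{t+1}` is again a centred normal
variable, and its standard deviation obeys `s_{t+1}² = s_t² + 2ρσ s_t + σ²`. Because `ρ < 0`, the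
`s_t` are bounded (`stdDev_le`), and since the innovation variance `σ² (1 - ρ²)` is constant, the
correlation of `Y_t` and `Y_{t+1}` is at most some `q < 1` in absolute value
(`exists_abs_stepCorr_le`).

Hence `Y_t / s_t` moves by the Mehler operators `mehler r`, which compose by multiplying the
correlations (`mehler_mehler`): over `k` steps the correlation is at most `q ^ k`. By the Markov
property, the conditional probability of an event of the future from time `t + k` is a function of
`Y_{t+k}` (`IsMehlerChain.exists_setLIntegral_eq`). Therefore the coefficient between past and
future is bounded by the `L¹` distance between a bivariate normal law of correlation `R`,
`|R| ≤ q ^ k`, and the product of its margins (`IsMehlerChain.betaTilde_le`), uniformly in `t ≥ 1`.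
That distance tends to `0` as `R → 0` by Scheffé's argument (`tendsto_mehlerDist`). The degenerate
time `t = 0` reduces to `t = 1` by monotonicity in the `σ`-fields.
-/

namespace CopulaMarkov

local notation "γ" => gaussianReal 0 1

/-! ### Mehler transitions and their densities -/

lemma map_linear_gaussianReal_prod (a b : ℝ) :
    ((gaussianReal 0 1).prod (gaussianReal 0 1)).map (fun p : ℝ × ℝ => a * p.1 + b * p.2) =
      gaussianReal 0 (a ^ 2 + b ^ 2).toNNReal := by
  have h1 := gaussianReal_map_const_mul (μ := 0) (v := 1) a
  have h2 := gaussianReal_map_const_mul (μ := 0) (v := 1) b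
  have h := gaussianReal_conv_gaussianReal (m₁ := a * 0) (m₂ := b * 0)
    (v₁ := NNReal.mk (a ^ 2) (sq_nonneg _) * 1) (v₂ := NNReal.mk (b ^ 2) (sq_nonneg _) * 1)
  rw [Measure.conv, ← h1, ← h2, Measure.map_prod_map _ _ (by fun_prop) (by fun_prop),
    Measure.map_map (by fun_prop) (by fun_prop)] at h
  refine Eq.trans ?_ (h.trans ?_)
  · rfl
  · congr 1
    · simp
    · ext
      simp only [mul_one, NNReal.coe_add, Real.coe_toNNReal _ (by positivity : 0 ≤ a ^ 2 + b ^ 2)]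
      rfl

/-- The Mehler (Ornstein–Uhlenbeck) transition operator with correlation `r`. -/
noncomputable def mehler (r : ℝ) (f : ℝ → ℝ≥0∞) (x : ℝ) : ℝ≥0∞ :=
  ∫⁻ y, f (r * x + √(1 - r ^ 2) * y) ∂γ

lemma measurable_mehler (r : ℝ) {f : ℝ → ℝ≥0∞} (hf : Measurable f) : Measurable (mehler r f) := by
  unfold mehler
  exact Measurable.lintegral_prod_right' (f := fun p : ℝ × ℝ => f (r * p.1 + √(1 - r ^ 2) * p.2))
    (by fun_prop)

lemma mehler_mehler {r r' : ℝ} (hr : r ^ 2 ≤ 1) (hr' : r' ^ 2 ≤ 1) {f : ℝ → ℝ≥0∞}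
    (hf : Measurable f) (x : ℝ) : mehler r (mehler r' f) x = mehler (r * r') f x := by
  have hsq : (r' * √(1 - r ^ 2)) ^ 2 + √(1 - r' ^ 2) ^ 2 = √(1 - (r * r') ^ 2) ^ 2 + 0 ^ 2 := by
    rw [mul_pow, Real.sq_sqrt (by linarith), Real.sq_sqrt (by linarith), Real.sq_sqrt]
    · ring
    · nlinarith [sq_nonneg r, sq_nonneg r']
  have hlaw := (map_linear_gaussianReal_prod (r' * √(1 - r ^ 2)) (√(1 - r' ^ 2))).trans
    ((congrArg (fun v : ℝ => gaussianReal 0 v.toNNReal) hsq).trans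
      (map_linear_gaussianReal_prod (√(1 - (r * r') ^ 2)) 0).symm)
  have h2 := congrArg (fun m : Measure ℝ => ∫⁻ y, f (r * r' * x + y) ∂m) hlaw
  rw [lintegral_map (by fun_prop) (by fun_prop), lintegral_map (by fun_prop) (by fun_prop),
    lintegral_prod _ (by fun_prop), lintegral_prod _ (by fun_prop)] at h2
  simp only [zero_mul, add_zero, lintegral_const, measure_univ, mul_one] at h2
  unfold mehler
  rw [← h2]
  refine lintegral_congr fun y => lintegral_congr fun z => ?_
  congr 1
  ring

/-- The density of `N(r x, 1 - r²)` with respect to `N(0, 1)`, as a function of `(x, y)`: the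
density of the bivariate normal law with correlation `r` with respect to the product of its
margins. -/
noncomputable def mehlerDensity (r x y : ℝ) : ℝ :=
  gaussianPDFReal (r * x) (1 - r ^ 2).toNNReal y / gaussianPDFReal 0 1 y

@[fun_prop]
lemma measurable_mehlerDensity (r : ℝ) :
    Measurable (fun p : ℝ × ℝ => mehlerDensity r p.1 p.2) := by
  unfold mehlerDensity gaussianPDFReal
  fun_prop

lemma measurable_mehlerDensity_right (r x : ℝ) : Measurable (mehlerDensity r x) := by
  unfold mehlerDensity gaussianPDFReal
  fun_prop

lemma mehlerDensity_nonneg (r x y : ℝ) : 0 ≤ mehlerDensity r x y :=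
  div_nonneg (gaussianPDFReal_nonneg _ _ _) (gaussianPDFReal_nonneg _ _ _)

lemma tendsto_mehlerDensity (x y : ℝ) :
    Tendsto (fun r => mehlerDensity r x y) (𝓝 0) (𝓝 1) := by
  have hpos := gaussianPDFReal_pos 0 1 y one_ne_zero
  have h : ContinuousAt (fun r : ℝ => mehlerDensity r x y) 0 := by
    unfold mehlerDensity
    refine ContinuousAt.div ?_ continuousAt_const hpos.ne'
    unfold gaussianPDFReal
    have hc : ContinuousAt (fun r : ℝ => (((1 - r ^ 2).toNNReal : NNReal) : ℝ)) 0 := by fun_prop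
    have h0 : (((1 - (0 : ℝ) ^ 2).toNNReal : NNReal) : ℝ) = 1 := by norm_num
    refine ContinuousAt.mul (ContinuousAt.inv₀ (by fun_prop) ?_)
      (ContinuousAt.rexp (ContinuousAt.div (by fun_prop) (by fun_prop) ?_))
    · rw [h0]; positivity
    · rw [h0]; norm_num
  have h1 : mehlerDensity 0 x y = 1 := by
    unfold mehlerDensity
    simp [hpos.ne']
  simpa [h1] using h.tendsto

lemma mehler_eq_lintegral_mehlerDensity {r : ℝ} (hr : r ^ 2 < 1) {f : ℝ → ℝ≥0∞}
    (hf : Measurable f) (x : ℝ) :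
    mehler r f x = ∫⁻ y, f y * ENNReal.ofReal (mehlerDensity r x y) ∂γ := by
  have hv : (1 - r ^ 2).toNNReal ≠ 0 := by simpa using hr
  have hlaw : (γ).map (fun y => r * x + √(1 - r ^ 2) * y)
      = gaussianReal (r * x) (1 - r ^ 2).toNNReal := by
    have h1 := gaussianReal_map_const_mul (μ := 0) (v := 1) (√(1 - r ^ 2))
    have h2 := congrArg (fun m : Measure ℝ => m.map (fun y => r * x + y)) h1
    rw [Measure.map_map (by fun_prop) (by fun_prop), gaussianReal_map_const_add] at h2
    refine h2.trans ?_
    congr 1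
    · simp
    · ext
      rw [Real.coe_toNNReal _ (by linarith), mul_one]
      exact Real.sq_sqrt (by linarith)
  unfold mehler
  rw [← lintegral_map hf (by fun_prop : Measurable fun y => r * x + √(1 - r ^ 2) * y), hlaw,
    gaussianReal_of_var_ne_zero _ hv, gaussianReal_of_var_ne_zero _ one_ne_zero,
    lintegral_withDensity_eq_lintegral_mul _ (measurable_gaussianPDF _ _) hf,
    lintegral_withDensity_eq_lintegral_mul _ (measurable_gaussianPDF _ _)]
  · refine lintegral_congr fun y => ?_
    have hpos := gaussianPDFReal_pos 0 1 y one_ne_zero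
    simp only [Pi.mul_apply, gaussianPDF]
    rw [mul_left_comm, ← ENNReal.ofReal_mul hpos.le, mehlerDensity, mul_div_cancel₀ _ hpos.ne',
      mul_comm]
  · exact hf.mul (measurable_mehlerDensity_right r x).ennreal_ofReal

/-- The total variation distance (as an `L¹` norm) between the bivariate normal law with
correlation `r` and the product of its margins. -/
noncomputable def mehlerDist (r : ℝ) : ℝ≥0∞ :=
  ∫⁻ x, ∫⁻ y, ENNReal.ofReal |mehlerDensity r x y - 1| ∂γ ∂γ

/-- Scheffé's argument: since the density has integral one, its `L¹` distance to `1` is twice the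
integral of the positive part of `1 - density`, which is bounded by `1` and tends to `0`. -/
lemma tendsto_mehlerDist : Tendsto mehlerDist (𝓝 0) (𝓝 0) := by
  have hm2 : ∀ r, Measurable
      (fun p : ℝ × ℝ => 2 * ENNReal.ofReal (1 - mehlerDensity r p.1 p.2)) := fun r =>
    ((measurable_mehlerDensity r).const_sub 1).ennreal_ofReal.const_mul 2
  have key : ∀ r : ℝ, r ^ 2 < 1 → mehlerDist r =
      ∫⁻ p, 2 * ENNReal.ofReal (1 - mehlerDensity r p.1 p.2) ∂(γ).prod γ := by
    intro r hr
    rw [lintegral_prod _ (hm2 r).aemeasurable, mehlerDist]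
    refine lintegral_congr fun x => ?_
    have hone : ∫⁻ y, ENNReal.ofReal (mehlerDensity r x y) ∂γ = 1 := by
      have := mehler_eq_lintegral_mehlerDensity hr (measurable_const (a := (1 : ℝ≥0∞))) x
      simpa [mehler] using this.symm
    have hm' := measurable_mehlerDensity_right r x
    -- `|D - 1| + 1 = 2 (1 - D)⁺ + D` avoids subtracting extended reals
    have hpt : ∫⁻ y, (ENNReal.ofReal |mehlerDensity r x y - 1| + 1) ∂γ =
        ∫⁻ y, (2 * ENNReal.ofReal (1 - mehlerDensity r x y)
          + ENNReal.ofReal (mehlerDensity r x y)) ∂γ := by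
      refine lintegral_congr fun y => ?_
      have h0 := mehlerDensity_nonneg r x y
      rw [← ENNReal.ofReal_one, ← ENNReal.ofReal_add (abs_nonneg _) zero_le_one]
      rcases le_total (mehlerDensity r x y) 1 with h | h
      · rw [← ENNReal.ofReal_ofNat 2, ← ENNReal.ofReal_mul (by norm_num),
          ← ENNReal.ofReal_add (by linarith) h0, abs_of_nonpos (by linarith)]
        congr 1
        ring
      · rw [ENNReal.ofReal_of_nonpos (by linarith : 1 - mehlerDensity r x y ≤ 0), mul_zero,
          zero_add, abs_of_nonneg (by linarith)]
        congr 1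
        ring
    rw [lintegral_add_right _ measurable_const, lintegral_add_right _ hm'.ennreal_ofReal, hone] at hpt
    simpa using hpt
  have hlim : Tendsto (fun r : ℝ =>
      ∫⁻ p, 2 * ENNReal.ofReal (1 - mehlerDensity r p.1 p.2) ∂(γ).prod γ) (𝓝 0)
      (𝓝 (∫⁻ _, 0 ∂(γ).prod γ)) := by
    refine tendsto_lintegral_filter_of_dominated_convergence (fun _ => 2)
      (Eventually.of_forall fun r => (hm2 r))
      (Eventually.of_forall fun r => ae_of_all _ fun p => ?_) (by simp)
      (ae_of_all _ fun p => ?_)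
    · have h0 := mehlerDensity_nonneg r p.1 p.2
      calc 2 * ENNReal.ofReal (1 - mehlerDensity r p.1 p.2) ≤ 2 * 1 := by
            gcongr
            rw [ENNReal.ofReal_le_one]
            linarith
        _ = 2 := mul_one _
    · have h := ((tendsto_mehlerDensity p.1 p.2).const_sub 1)
      have h' := ENNReal.Tendsto.const_mul (a := 2) (ENNReal.tendsto_ofReal h) (Or.inr (by simp))
      simpa using h'
  rw [lintegral_zero] at hlim
  refine hlim.congr' ?_
  have hev : ∀ᶠ r : ℝ in 𝓝 0, r ^ 2 < 1 := by
    have : ContinuousAt (fun r : ℝ => r ^ 2) 0 := by fun_prop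
    exact this.eventually_lt continuousAt_const (by norm_num)
  filter_upwards [hev] with r hr using (key r hr).symm

/-! ### Gaussian copulas and the standardised process -/

lemma cdf_stdGaussian_le_iff (a b : ℝ) :
    cdf (gaussianReal 0 1) a ≤ cdf (gaussianReal 0 1) b ↔ a ≤ b := by
  refine StrictMono.le_iff_le (f := cdf (gaussianReal 0 1)) fun x y hxy => ?_
  have h : 0 < (cdf (gaussianReal 0 1)).measure (Set.Ioc x y) := by
    rw [measure_cdf, pos_iff_ne_zero]
    intro h0
    have := gaussianReal_absolutelyContinuous' 0 (one_ne_zero (α := NNReal)) h0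
    simp [hxy.not_ge] at this
  rw [StieltjesFunction.measure_Ioc, ENNReal.ofReal_pos] at h
  linarith

instance (ρ : ℝ) : IsProbabilityMeasure (bivariateNormal ρ) :=
  Measure.isProbabilityMeasure_map (by fun_prop)

lemma map_fst_of_map_prodMk {Ω : Type*} [MeasurableSpace Ω] {μ : Measure Ω} {X Z : Ω → ℝ} {ρ : ℝ}
    (hX : Measurable X) (hZ : Measurable Z)
    (h : μ.map (fun ω => (X ω, Z ω)) = bivariateNormal ρ) : μ.map X = gaussianReal 0 1 := by
  have h1 := congrArg (fun m : Measure (ℝ × ℝ) => m.map Prod.fst) h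
  rw [bivariateNormal, Measure.map_map (by fun_prop) (by fun_prop),
    Measure.map_map (by fun_prop) (by fun_prop)] at h1
  refine h1.trans ?_
  change ((gaussianReal 0 1).prod (gaussianReal 0 1)).map Prod.fst = gaussianReal 0 1
  simp

/-- Probability measures on the plane are determined by their distribution
functions. -/
lemma ext_of_Iic_prod {m₁ m₂ : Measure (ℝ × ℝ)} [IsProbabilityMeasure m₁] [IsProbabilityMeasure m₂]
    (h : ∀ x z : ℝ, m₁ (Set.Iic x ×ˢ Set.Iic z) = m₂ (Set.Iic x ×ˢ Set.Iic z)) : m₁ = m₂ := by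
  have hspan : IsCountablySpanning (Set.range (Set.Iic : ℝ → Set ℝ)) :=
    ⟨fun n : ℕ => Set.Iic (n : ℝ), fun n => ⟨n, rfl⟩, by
      refine Set.eq_univ_of_forall fun x => ?_
      obtain ⟨n, hn⟩ := exists_nat_ge x
      exact Set.mem_iUnion.2 ⟨n, hn⟩⟩
  have hg : MeasurableSpace.generateFrom (Set.range (Set.Iic : ℝ → Set ℝ)) =
      (inferInstance : MeasurableSpace ℝ) :=
    (borel_eq_generateFrom_Iic ℝ).symm.trans (BorelSpace.measurable_eq (α := ℝ)).symm
  refine ext_of_generate_finite _ (generateFrom_eq_prod hg hg hspan hspan).symm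
    (isPiSystem_Iic.prod isPiSystem_Iic) ?_ (by simp)
  rintro _ ⟨_, ⟨x, rfl⟩, _, ⟨z, rfl⟩, rfl⟩
  exact h x z

/-- Sklar's theorem for Gaussian margins: a vector with the Gaussian copula and centred Gaussian
margins is a rescaled bivariate normal vector. -/
lemma map_prodMk_of_hasCopula {Ω : Type*} [MeasurableSpace Ω] {μ : Measure Ω}
    [IsProbabilityMeasure μ] {X Z : Ω → ℝ} {a b ρ : ℝ} (ha : 0 < a) (hb : 0 < b)
    (hX : HasLaw X (gaussianReal 0 (a ^ 2).toNNReal) μ)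
    (hZ : HasLaw Z (gaussianReal 0 (b ^ 2).toNNReal) μ)
    (hC : HasCopula μ X Z (gaussianCopula ρ)) :
    μ.map (fun ω => (X ω, Z ω)) = (bivariateNormal ρ).map (fun p => (a * p.1, b * p.2)) := by
  have hXm := hX.aemeasurable
  have hZm := hZ.aemeasurable
  -- a centred normal distribution function is the standard one after rescaling
  have hmarg : ∀ {c : ℝ} {U : Ω → ℝ}, 0 < c → HasLaw U (gaussianReal 0 (c ^ 2).toNNReal) μ →
      ∀ u, μ.real {ω | U ω ≤ u} = cdf (gaussianReal 0 1) (u / c) := by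
    intro c U hc hU u
    have h1 := gaussianReal_map_const_mul (μ := 0) (v := 1) c
    have h2 : gaussianReal 0 (c ^ 2).toNNReal = (gaussianReal 0 1).map (fun x => c * x) := by
      rw [h1]
      congr 1
      · simp
      · ext
        simp [sq_nonneg]
    have h3 : {x : ℝ | x ≤ u} = Set.Iic u := rfl
    rw [cdf_eq_real, measureReal_def, measureReal_def,
      hU.measure_eq (p := fun v => v ≤ u) measurableSet_Iic, h2, h3,
      Measure.map_apply (by fun_prop) measurableSet_Iic]
    congr 2
    ext x
    simp [le_div_iff₀ hc, mul_comm]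
  have := Measure.isProbabilityMeasure_map (μ := μ) (hXm.prodMk hZm)
  have : IsProbabilityMeasure ((bivariateNormal ρ).map (fun p => (a * p.1, b * p.2))) :=
    Measure.isProbabilityMeasure_map (by fun_prop)
  refine ext_of_Iic_prod fun x z => ?_
  have h := hC x z
  rw [hmarg ha hX, hmarg hb hZ, gaussianCopula] at h
  -- strict monotonicity of `Φ` turns the copula identity into one of distribution functions
  simp only [cdf_stdGaussian_le_iff] at h
  rw [measureReal_def, measureReal_def,
    ENNReal.toReal_eq_toReal_iff' (measure_ne_top _ _) (measure_ne_top _ _)] at h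
  rw [Measure.map_apply_of_aemeasurable (hXm.prodMk hZm) (measurableSet_Iic.prod measurableSet_Iic),
    Measure.map_apply (by fun_prop) (measurableSet_Iic.prod measurableSet_Iic)]
  refine h.trans ?_
  congr 1
  ext p
  simp [le_div_iff₀ ha, le_div_iff₀ hb, mul_comm]

/-- The standard deviation of `Y_t`, with `Y_0 = 0`; the radicand is nonnegative for `|ρ| ≤ 1`. -/
noncomputable def stdDev (σ ρ : ℝ) : ℕ → ℝ
  | 0 => 0
  | t + 1 => √(stdDev σ ρ t ^ 2 + 2 * ρ * σ * stdDev σ ρ t + σ ^ 2)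

/-- The correlation of `Y_t` and `Y_{t+1}` for `t ≥ 1`; at `t = 0` the state is degenerate and the
value carries no meaning. -/
noncomputable def stepCorr (σ ρ : ℝ) (t : ℕ) : ℝ :=
  (stdDev σ ρ t + ρ * σ) / stdDev σ ρ (t + 1)

section

variable {σ ρ : ℝ}

lemma stdDev_nonneg (t : ℕ) : 0 ≤ stdDev σ ρ t := by
  cases t with
  | zero => exact le_rfl
  | succ t => exact Real.sqrt_nonneg _

lemma stdDev_succ_sq (hρ : ρ ∈ Set.Ioo (-1 : ℝ) 0) (t : ℕ) : stdDev σ ρ (t + 1) ^ 2 =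
    (stdDev σ ρ t + ρ * σ) ^ 2 + σ ^ 2 * (1 - ρ ^ 2) := by
  have h1 : 0 < 1 - ρ ^ 2 := by nlinarith [hρ.1, hρ.2]
  have h := mul_nonneg (sq_nonneg σ) h1.le
  rw [stdDev, Real.sq_sqrt]
  · ring
  · nlinarith [sq_nonneg (stdDev σ ρ t + ρ * σ)]

lemma stdDev_succ_pos (hσ : 0 < σ) (hρ : ρ ∈ Set.Ioo (-1 : ℝ) 0) (t : ℕ) :
    0 < stdDev σ ρ (t + 1) := by
  have h1 : 0 < 1 - ρ ^ 2 := by nlinarith [hρ.1, hρ.2]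
  have h := stdDev_succ_sq (σ := σ) hρ t
  have h2 : 0 < σ ^ 2 * (1 - ρ ^ 2) := by positivity
  refine (stdDev_nonneg _).lt_of_ne fun h0 => ?_
  rw [← h0] at h
  nlinarith [sq_nonneg (stdDev σ ρ t + ρ * σ)]

/-- Negative correlation of the increments keeps the variance bounded. -/
lemma stdDev_le (hσ : 0 < σ) (hρ : ρ ∈ Set.Ioo (-1 : ℝ) 0) (t : ℕ) :
    stdDev σ ρ t ≤ σ + σ / (-ρ) := by
  have hρ0 : 0 < -ρ := by linarith [hρ.2]
  have hd : 0 < σ / (-ρ) := by positivity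
  induction t with
  | zero => simp only [stdDev]; positivity
  | succ t ih =>
    have h0 := stdDev_nonneg (σ := σ) (ρ := ρ) t
    rw [stdDev]
    refine Real.sqrt_le_iff.2 ⟨by positivity, ?_⟩
    -- above `σ / (-ρ)` the variance decreases, and below it one step adds at most `σ`
    rcases le_total (stdDev σ ρ t) (σ / (-ρ)) with h | h
    · have h3 : 0 ≤ -ρ * (σ * stdDev σ ρ t) := by positivity
      nlinarith
    · have h3 : σ ≤ -ρ * stdDev σ ρ t := by
        rw [div_le_iff₀ hρ0] at h
        linarith
      nlinarith

lemma one_sub_stepCorr_sq (hσ : 0 < σ) (hρ : ρ ∈ Set.Ioo (-1 : ℝ) 0) (t : ℕ) :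
    1 - stepCorr σ ρ t ^ 2 = σ ^ 2 * (1 - ρ ^ 2) / stdDev σ ρ (t + 1) ^ 2 := by
  have h := stdDev_succ_pos hσ hρ t
  rw [stepCorr, div_pow, eq_div_iff (by positivity), sub_mul, div_mul_cancel₀ _ (by positivity),
    stdDev_succ_sq hρ t]
  ring

lemma sqrt_one_sub_stepCorr_sq (hσ : 0 < σ) (hρ : ρ ∈ Set.Ioo (-1 : ℝ) 0) (t : ℕ) :
    √(1 - stepCorr σ ρ t ^ 2) = σ * √(1 - ρ ^ 2) / stdDev σ ρ (t + 1) := by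
  have h := stdDev_succ_pos hσ hρ t
  rw [one_sub_stepCorr_sq hσ hρ, Real.sqrt_div' _ (by positivity), Real.sqrt_sq h.le,
    Real.sqrt_mul (by positivity), Real.sqrt_sq hσ.le]

lemma exists_abs_stepCorr_le (hσ : 0 < σ) (hρ : ρ ∈ Set.Ioo (-1 : ℝ) 0) :
    ∃ q : ℝ, 0 ≤ q ∧ q < 1 ∧ ∀ t, |stepCorr σ ρ t| ≤ q := by
  have hρ0 : 0 < -ρ := by linarith [hρ.2]
  have h1 : 0 < 1 - ρ ^ 2 := by nlinarith [hρ.1, hρ.2]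
  set c := σ ^ 2 * (1 - ρ ^ 2) / (σ + σ / (-ρ)) ^ 2 with hc
  have hS : 0 < σ + σ / (-ρ) := by positivity
  have hcpos : 0 < c := by positivity
  refine ⟨√(1 - c), Real.sqrt_nonneg _, ?_, fun t => ?_⟩
  · rw [Real.sqrt_lt' one_pos]
    linarith
  · refine Real.abs_le_sqrt ?_
    have h := one_sub_stepCorr_sq hσ hρ t
    have hp := stdDev_succ_pos hσ hρ t
    have : c ≤ σ ^ 2 * (1 - ρ ^ 2) / stdDev σ ρ (t + 1) ^ 2 := by
      rw [hc]
      gcongr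
      exact stdDev_le hσ hρ _
    linarith

end

/-- Consecutive standardised states are bivariate normal from time `1` on. -/
lemma map_standardised_pair {Ω : Type*} [MeasurableSpace Ω] {μ : Measure Ω}
    [IsProbabilityMeasure μ] {σ ρ : ℝ} (hσ : 0 < σ) (hρ : ρ ∈ Set.Ioo (-1 : ℝ) 0)
    {Y ξ : ℕ → Ω → ℝ} (hmeas : ∀ t, Measurable (Y t))
    (hY0 : ∀ᵐ ω ∂μ, Y 0 ω = 0)
    (hY : ∀ t : ℕ, 1 ≤ t → ∀ᵐ ω ∂μ, Y t ω = Y (t - 1) ω + ξ t ω)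
    (hξ : ∀ t : ℕ, 1 ≤ t → HasLaw (ξ t) (gaussianReal 0 (Real.toNNReal (σ ^ 2))) μ)
    (hC : ∀ t : ℕ, 1 ≤ t → HasCopula μ (Y (t - 1)) (ξ t) (gaussianCopula ρ)) (t : ℕ) :
    μ.map (fun ω => (Y (t + 1) ω / stdDev σ ρ (t + 1), Y (t + 2) ω / stdDev σ ρ (t + 2))) =
      bivariateNormal (stepCorr σ ρ (t + 1)) := by
  have hpair : ∀ t, HasLaw (Y (t + 1)) (gaussianReal 0 (stdDev σ ρ (t + 1) ^ 2).toNNReal) μ →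
      μ.map (fun ω => (Y (t + 1) ω, Y (t + 2) ω)) = ((γ).prod γ).map (fun p =>
        (stdDev σ ρ (t + 1) * p.1, (stdDev σ ρ (t + 1) + ρ * σ) * p.1 + σ * √(1 - ρ ^ 2) * p.2)) := by
    intro t ht
    have h1 := map_prodMk_of_hasCopula (stdDev_succ_pos hσ hρ t) hσ ht (hξ (t + 2) (by omega))
      (hC (t + 2) (by omega))
    have h2 : μ.map (fun ω => (Y (t + 1) ω, Y (t + 2) ω)) =
        (μ.map (fun ω => (Y (t + 1) ω, ξ (t + 2) ω))).map (fun p => (p.1, p.1 + p.2)) := by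
      rw [AEMeasurable.map_map_of_aemeasurable (by fun_prop)
        ((hmeas _).aemeasurable.prodMk (hξ (t + 2) (by omega)).aemeasurable)]
      refine Measure.map_congr ?_
      filter_upwards [hY (t + 2) (by omega)] with ω hω
      simp [hω]
    rw [h2, h1, bivariateNormal, Measure.map_map (by fun_prop) (by fun_prop),
      Measure.map_map (by fun_prop) (by fun_prop)]
    congr 1
    ext p
    · rfl
    · simp only [Function.comp_apply]
      ring
  have hlaw : ∀ t, HasLaw (Y (t + 1)) (gaussianReal 0 (stdDev σ ρ (t + 1) ^ 2).toNNReal) μ := by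
    intro t
    induction t with
    | zero =>
      have h := hξ 1 le_rfl
      refine ⟨(hmeas _).aemeasurable, ?_⟩
      have : stdDev σ ρ (0 + 1) ^ 2 = σ ^ 2 := by
        simp [stdDev, Real.sqrt_sq hσ.le]
      rw [this, ← h.map_eq]
      refine Measure.map_congr ?_
      filter_upwards [hY0, hY 1 le_rfl] with ω h0 h1
      simp [h1, h0]
    | succ t ih =>
      refine ⟨(hmeas _).aemeasurable, ?_⟩
      have h := congrArg (fun m : Measure (ℝ × ℝ) => m.map Prod.snd) (hpair t ih)
      rw [Measure.map_map (by fun_prop) (by fun_prop),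
        Measure.map_map (by fun_prop) (by fun_prop)] at h
      refine h.trans ((map_linear_gaussianReal_prod _ _).trans ?_)
      rw [stdDev_succ_sq hρ, mul_pow, Real.sq_sqrt]
      nlinarith [hρ.1, hρ.2]
  have h := congrArg (fun m : Measure (ℝ × ℝ) => m.map
    (fun p => (p.1 / stdDev σ ρ (t + 1), p.2 / stdDev σ ρ (t + 2)))) (hpair t (hlaw t))
  rw [Measure.map_map (by fun_prop) (by fun_prop),
    Measure.map_map (by fun_prop) (by fun_prop)] at h
  refine h.trans ?_
  rw [bivariateNormal, sqrt_one_sub_stepCorr_sq hσ hρ]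
  congr 1
  have h1 := stdDev_succ_pos hσ hρ t
  have h2 := stdDev_succ_pos hσ hρ (t + 1)
  ext p
  · simp only [Function.comp_apply]
    field_simp
  · simp only [Function.comp_apply, stepCorr]
    ring

/-! ### The Markov property for past and future events -/

lemma sigmaField_singleton {Ω T : Type*} (X : T → Ω → ℝ) (t : T) :
    sigmaField X {t} = MeasurableSpace.comap (X t) inferInstance := by
  simp [sigmaField]

lemma sigmaField_mono {Ω T : Type*} (X : T → Ω → ℝ) {S S' : Set T} (h : S ⊆ S') :
    sigmaField X S ≤ sigmaField X S' :=
  biSup_mono h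

lemma sigmaField_le {Ω T : Type*} [MeasurableSpace Ω] {X : T → Ω → ℝ}
    (h : ∀ t, Measurable (X t)) (S : Set T) :
    sigmaField X S ≤ ‹MeasurableSpace Ω› :=
  iSup₂_le fun t _ => (h t).comap_le

lemma measurable_sigmaField {Ω T : Type*} (X : T → Ω → ℝ) {S : Set T} {t : T} (h : t ∈ S) :
    Measurable[sigmaField X S] (X t) :=
  Measurable.mono (comap_measurable (X t))
    (le_iSup₂_of_le (f := fun s (_ : s ∈ S) => MeasurableSpace.comap (X s) inferInstance)
      t h le_rfl) le_rfl

section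
variable {Ω : Type*} [MeasurableSpace Ω] {μ : Measure Ω} {Y : ℕ → Ω → ℝ}

/-- One step of the chain: by the Markov property, a bivariate normal law of the standardised pair
determines the conditional law of the next state given the whole past. -/
lemma IsMarkovProcess.setLIntegral_succ [IsProbabilityMeasure μ] (hM : IsMarkovProcess μ Y)
    {t : ℕ} {c d r : ℝ} (hc : c ≠ 0)
    (hpair : μ.map (fun ω => (Y t ω / c, Y (t + 1) ω / d)) = bivariateNormal r)
    {E : Set Ω} (hE : MeasurableSet[sigmaField Y (Set.Iic t)] E)
    {f : ℝ → ℝ≥0∞} (hf : Measurable f) :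
    ∫⁻ ω in E, f (Y (t + 1) ω / d) ∂μ = ∫⁻ ω in E, mehler r f (Y t ω / c) ∂μ := by
  obtain ⟨hmeas, hcond⟩ := hM
  have hm := hmeas t
  have hm' := hmeas (t + 1)
  have hle := sigmaField_le hmeas (Set.Iic t)
  have hle' := sigmaField_le hmeas {t}
  have hind : ∀ A : Set ℝ, MeasurableSet A → Measurable (A.indicator (1 : ℝ → ℝ≥0∞)) :=
    fun A hA => measurable_one.indicator hA
  -- the identity for events of `σ(Y_t)` is a statement about the law of the pair
  have hnow : ∀ A C : Set ℝ, MeasurableSet A → MeasurableSet C →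
      ∫⁻ ω in (fun ω => Y t ω / c) ⁻¹' C, mehler r (A.indicator 1) (Y t ω / c) ∂μ =
        μ ((fun ω => Y t ω / c) ⁻¹' C ∩ (fun ω => Y (t + 1) ω / d) ⁻¹' A) := by
    intro A C hA hC
    have h1' : μ.map (fun ω => Y t ω / c) = γ := map_fst_of_map_prodMk
      (X := fun ω => Y t ω / c) (Z := fun ω => Y (t + 1) ω / d) (by fun_prop) (by fun_prop) hpair
    have h2 := congrArg (fun m : Measure (ℝ × ℝ) => m (C ×ˢ A)) hpair
    rw [bivariateNormal, Measure.map_apply (by fun_prop) (hC.prod hA),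
      Measure.map_apply (by fun_prop) (hC.prod hA)] at h2
    have h3 : (fun ω => (Y t ω / c, Y (t + 1) ω / d)) ⁻¹' C ×ˢ A =
      (fun ω => Y t ω / c) ⁻¹' C ∩ (fun ω => Y (t + 1) ω / d) ⁻¹' A := rfl
    rw [← h3, h2, ← setLIntegral_map hC (measurable_mehler r (hind A hA)) (by fun_prop), h1',
      Measure.prod_apply ((hC.prod hA).preimage (by fun_prop)), ← lintegral_indicator hC]
    refine lintegral_congr fun x => ?_
    by_cases hx : x ∈ C
    · have hset : Prod.mk x ⁻¹'
          ((fun z : ℝ × ℝ => (z.1, r * z.1 + √(1 - r ^ 2) * z.2)) ⁻¹' C ×ˢ A) =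
          (fun y => r * x + √(1 - r ^ 2) * y) ⁻¹' A := by
        ext y
        simp [hx]
      rw [Set.indicator_of_mem hx, hset, ← lintegral_indicator_one (hA.preimage (by fun_prop))]
      rfl
    · rw [Set.indicator_of_notMem hx, eq_comm,
        show (Prod.mk x ⁻¹' _ : Set ℝ) = ∅ from by ext y; simp [hx], measure_empty]
  have hle1 : ∀ A : Set ℝ, ∀ x, mehler r (A.indicator 1) x ≤ 1 := by
    intro A x
    calc mehler r (A.indicator 1) x ≤ ∫⁻ _, 1 ∂γ :=
          lintegral_mono fun y => Set.indicator_le_self' (fun _ _ => zero_le) _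
      _ = 1 := by simp
  -- the Markov property transfers it to events of the past
  have hpast : ∀ A : Set ℝ, MeasurableSet A →
      μ (E ∩ (fun ω => Y (t + 1) ω / d) ⁻¹' A) =
        ∫⁻ ω in E, mehler r (A.indicator 1) (Y t ω / c) ∂μ := by
    intro A hA
    set S := (fun ω => Y (t + 1) ω / d) ⁻¹' A with hS
    have hSm : MeasurableSet S := hA.preimage (by fun_prop)
    set h := fun ω => (mehler r (A.indicator 1) (Y t ω / c)).toReal with hh
    have hhm0 : Measurable fun y : ℝ => (mehler r (A.indicator 1) (y / c)).toReal :=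
      ((measurable_mehler r (hind A hA)).comp (by fun_prop)).ennreal_toReal
    have hhm : Measurable h := hhm0.comp hm
    have hlint : ∀ E' : Set Ω, ∫ ω in E', h ω ∂μ =
        (∫⁻ ω in E', mehler r (A.indicator 1) (Y t ω / c) ∂μ).toReal := by
      intro E'
      refine integral_toReal ?_ (ae_of_all _ fun ω => (hle1 A _).trans_lt ENNReal.one_lt_top)
      exact ((measurable_mehler r (hind A hA)).comp (by fun_prop)).aemeasurable
    have hhint : Integrable h μ := by
      refine Integrable.of_bound hhm.aestronglyMeasurable 1 (ae_of_all _ fun ω => ?_)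
      rw [Real.norm_of_nonneg ENNReal.toReal_nonneg]
      exact ENNReal.toReal_le_of_le_ofReal zero_le_one (by simpa using hle1 A _)
    have hSint : Integrable (S.indicator fun _ => (1 : ℝ)) μ :=
      (integrable_const 1).indicator hSm
    have hindint : ∀ E' : Set Ω, ∫ ω in E', S.indicator (fun _ => (1 : ℝ)) ω ∂μ =
        (μ (E' ∩ S)).toReal := by
      intro E'
      rw [integral_indicator hSm, setIntegral_const, measureReal_restrict_apply hSm, smul_eq_mul,
        mul_one, Set.inter_comm, measureReal_def]
    have hce : h =ᵐ[μ] μ⟦S | sigmaField Y {t}⟧ := by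
      refine ae_eq_condExp_of_forall_setIntegral_eq hle' hSint
        (fun _ _ _ => hhint.integrableOn) (fun E' hE' _ => ?_) ?_
      · rw [sigmaField_singleton] at hE'
        obtain ⟨C, hC, rfl⟩ := hE'
        have hCc : Y t ⁻¹' C = (fun ω => Y t ω / c) ⁻¹' ((fun x => c * x) ⁻¹' C) := by
          ext ω
          simp [mul_div_cancel₀ _ hc]
        rw [hlint, hindint, hCc, hnow A _ hA (hC.preimage (by fun_prop))]
      · exact (hhm0.comp (measurable_sigmaField Y (Set.mem_singleton t))).aestronglyMeasurable
    have hce' : h =ᵐ[μ] μ⟦S | sigmaField Y (Set.Iic t)⟧ :=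
      hce.trans (hcond t (t + 1) (Nat.le_succ t) ((fun y => y / d) ⁻¹' A)
        (hA.preimage (by fun_prop))).symm
    have hfin : ∫⁻ ω in E, mehler r (A.indicator 1) (Y t ω / c) ∂μ ≠ ∞ := by
      refine ((lintegral_mono fun ω => hle1 A _).trans_lt ?_).ne
      simp
    rw [← ENNReal.toReal_eq_toReal_iff' (measure_ne_top _ _) hfin, ← hlint, ← hindint,
      ← setIntegral_condExp hle hSint hE]
    exact setIntegral_congr_ae (hle _ hE) (hce'.mono fun ω hω _ => hω.symm)
  have hlaw : (μ.restrict E).map (fun ω => Y (t + 1) ω / d) =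
      (((μ.restrict E).map (fun ω => Y t ω / c)).prod γ).map
        (fun p => r * p.1 + √(1 - r ^ 2) * p.2) := by
    ext A hA
    rw [Measure.map_apply (by fun_prop) hA, Measure.restrict_apply (hA.preimage (by fun_prop)),
      Set.inter_comm, hpast A hA, ← lintegral_indicator_one hA, lintegral_map (hind A hA)
      (by fun_prop), lintegral_prod (fun p : ℝ × ℝ => A.indicator 1 (r * p.1 + √(1 - r ^ 2) * p.2))
      ((hind A hA).comp (by fun_prop)).aemeasurable]
    exact (lintegral_map (measurable_mehler r (hind A hA)) (by fun_prop)).symm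
  rw [← lintegral_map hf (by fun_prop : Measurable fun ω => Y (t + 1) ω / d), hlaw,
    lintegral_map hf (by fun_prop), lintegral_prod _ (by fun_prop)]
  exact lintegral_map (measurable_mehler r hf) (by fun_prop)

/-- `Y`, standardised by the scales `s`, is a Markov chain with Mehler transitions: the state at
time `t` divided by `s t` is standard normal, and the consecutive correlations are `r t`. Time `0`
is excluded, since there the state may be degenerate. -/
structure IsMehlerChain (μ : Measure Ω) (Y : ℕ → Ω → ℝ) (s r : ℕ → ℝ) : Prop where
  measurable : ∀ t, Measurable (Y t)
  scale_ne_zero : ∀ t, 1 ≤ t → s t ≠ 0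
  corr_sq_le_one : ∀ t, 1 ≤ t → r t ^ 2 ≤ 1
  map_eq : ∀ t, 1 ≤ t → μ.map (fun ω => Y t ω / s t) = gaussianReal 0 1
  setLIntegral_succ : ∀ t, 1 ≤ t → ∀ E, MeasurableSet[sigmaField Y (Set.Iic t)] E →
    ∀ f : ℝ → ℝ≥0∞, Measurable f →
      ∫⁻ ω in E, f (Y (t + 1) ω / s (t + 1)) ∂μ = ∫⁻ ω in E, mehler (r t) f (Y t ω / s t) ∂μ

namespace IsMehlerChain

variable {s r : ℕ → ℝ}

lemma setLIntegral_add (h : IsMehlerChain μ Y s r) {t : ℕ} (ht : 1 ≤ t) (k : ℕ) {E : Set Ω}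
    (hE : MeasurableSet[sigmaField Y (Set.Iic t)] E) {f : ℝ → ℝ≥0∞} (hf : Measurable f) :
    ∫⁻ ω in E, f (Y (t + k) ω / s (t + k)) ∂μ =
      ∫⁻ ω in E, mehler (∏ i ∈ Finset.range k, r (t + i)) f (Y t ω / s t) ∂μ := by
  induction k generalizing f with
  | zero => simp [mehler]
  | succ k ih =>
    have hE' := sigmaField_mono Y (Set.Iic_subset_Iic.2 (Nat.le_add_right t k)) _ hE
    have hprod : (∏ i ∈ Finset.range k, r (t + i)) ^ 2 ≤ 1 := by
      rw [← Finset.prod_pow]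
      exact Finset.prod_le_one (fun _ _ => sq_nonneg _)
        fun i _ => h.corr_sq_le_one _ (by omega)
    rw [← add_assoc, h.setLIntegral_succ _ (by omega) _ hE' _ hf, ih (measurable_mehler _ hf)]
    simp only [mehler_mehler hprod (h.corr_sq_le_one (t + k) (by omega)) hf,
      Finset.prod_range_succ]

/-- The conditional probability of a cylinder event of the future, given the past up to time `u`,
is a function of the state at time `u`. -/
lemma exists_cylinder (h : IsMehlerChain μ Y s r) (n : ℕ) :
    ∀ u, 1 ≤ u → ∀ A : ℕ → Set ℝ, (∀ i, MeasurableSet (A i)) →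
    ∃ g : ℝ → ℝ≥0∞, Measurable g ∧ ∀ E, MeasurableSet[sigmaField Y (Set.Iic u)] E →
      μ (E ∩ ⋂ i ∈ Finset.range n, Y (u + i) ⁻¹' A i) = ∫⁻ ω in E, g (Y u ω / s u) ∂μ := by
  induction n with
  | zero => exact fun u hu A hA => ⟨fun _ => 1, measurable_const, fun E hE => by simp⟩
  | succ n ih =>
    intro u hu A hA
    obtain ⟨g, hg, hgE⟩ := ih (u + 1) (by omega) (fun i => A (i + 1)) (fun i => hA _)
    have hAm : MeasurableSet ((fun x => s u * x) ⁻¹' A 0) := (hA 0).preimage (by fun_prop)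
    refine ⟨((fun x => s u * x) ⁻¹' A 0).indicator (mehler (r u) g),
      (measurable_mehler _ hg).indicator hAm, fun E hE => ?_⟩
    have hY0 : MeasurableSet[sigmaField Y (Set.Iic u)] (Y u ⁻¹' A 0) :=
      measurable_sigmaField Y (Set.mem_Iic.2 le_rfl) (hA 0)
    have hE' : MeasurableSet[sigmaField Y (Set.Iic u)] (E ∩ Y u ⁻¹' A 0) :=
      MeasurableSet.inter hE hY0
    have hsplit : E ∩ ⋂ i ∈ Finset.range (n + 1), Y (u + i) ⁻¹' A i =
        (E ∩ Y u ⁻¹' A 0) ∩ ⋂ i ∈ Finset.range n, Y (u + 1 + i) ⁻¹' A (i + 1) := by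
      ext ω
      simp only [Set.mem_inter_iff, Set.mem_iInter, Finset.mem_range, Set.mem_preimage, and_assoc,
        Nat.forall_lt_succ_left', add_zero, add_assoc, add_comm 1]
    rw [hsplit, hgE _ (sigmaField_mono Y (Set.Iic_subset_Iic.2 (Nat.le_succ u)) _ hE'),
      h.setLIntegral_succ u hu _ hE' g hg, Set.inter_comm,
      ← Measure.restrict_restrict (h.measurable u (hA 0)),
      ← lintegral_indicator (h.measurable u (hA 0))]
    refine lintegral_congr fun ω => ?_
    have hiff : Y u ω / s u ∈ (fun x => s u * x) ⁻¹' A 0 ↔ ω ∈ Y u ⁻¹' A 0 := by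
      simp [mul_div_cancel₀ _ (h.scale_ne_zero u hu)]
    by_cases hω : ω ∈ Y u ⁻¹' A 0
    · rw [Set.indicator_of_mem hω, Set.indicator_of_mem (hiff.2 hω)]
    · rw [Set.indicator_of_notMem hω, Set.indicator_of_notMem (fun h => hω (hiff.1 h))]

/-- The Markov property for the whole future: the conditional probability of a future event, given
the past up to time `u`, is a function of the state at time `u`. -/
lemma exists_setLIntegral_eq [IsProbabilityMeasure μ] (h : IsMehlerChain μ Y s r) {u : ℕ}
    (hu : 1 ≤ u) {B : Set Ω} (hB : MeasurableSet[sigmaField Y (Set.Ici u)] B) :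
    ∃ g : ℝ → ℝ≥0∞, Measurable g ∧ ∀ E, MeasurableSet[sigmaField Y (Set.Iic u)] E →
      μ (E ∩ B) = ∫⁻ ω in E, g (Y u ω / s u) ∂μ := by
  have hle := sigmaField_le h.measurable (Set.Ici u)
  have hle' := sigmaField_le h.measurable (Set.Iic u)
  have hYu := h.measurable u
  have hYuF : Measurable[sigmaField Y (Set.Iic u)] (Y u) :=
    measurable_sigmaField Y (Set.mem_Iic.2 le_rfl)
  refine MeasurableSpace.induction_on_inter (m := sigmaField Y (Set.Ici u))
    (C := fun B _ => ∃ g : ℝ → ℝ≥0∞, Measurable g ∧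
      ∀ E, MeasurableSet[sigmaField Y (Set.Iic u)] E →
        μ (E ∩ B) = ∫⁻ ω in E, g (Y u ω / s u) ∂μ)
    (generateFrom_piiUnionInter_measurableSet
      (fun i => MeasurableSpace.comap (Y i) inferInstance) (Set.Ici u)).symm
    (isPiSystem_piiUnionInter _
      (fun i => @MeasurableSpace.isPiSystem_measurableSet _ (MeasurableSpace.comap (Y i) _)) _)
    ?_ ?_ ?_ ?_ B hB
  · exact ⟨fun _ => 0, measurable_const, fun E _ => by simp⟩
  · rintro _ ⟨T, hT, f, hf, rfl⟩
    have hf' : ∀ x, ∃ A : Set ℝ, MeasurableSet A ∧ (x ∈ T → Y x ⁻¹' A = f x) ∧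
        (x ∉ T → A = Set.univ) := by
      intro x
      by_cases hx : x ∈ T
      · obtain ⟨A, hA, hAf⟩ := hf x hx
        exact ⟨A, hA, fun _ => hAf, fun h => absurd hx h⟩
      · exact ⟨Set.univ, .univ, fun h => absurd h hx, fun _ => rfl⟩
    choose A hA hAf hAu using hf'
    -- constrain all times `u, …, sup T`, trivially at the times outside `T`
    obtain ⟨g, hg, hgE⟩ := h.exists_cylinder (T.sup id + 1) u hu (fun i => A (u + i))
      (fun i => hA _)
    refine ⟨g, hg, fun E hE => ?_⟩
    rw [← hgE E hE]
    congr 2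
    ext ω
    simp only [Set.mem_iInter, Finset.mem_range]
    constructor
    · intro hω i _
      by_cases hi : u + i ∈ T
      · rw [hAf _ hi]
        exact hω _ hi
      · simp [hAu _ hi]
    · intro hω x hx
      have hux : u ≤ x := hT hx
      have hxT : x ≤ T.sup id := Finset.le_sup (f := id) hx
      have := hω (x - u) (by omega)
      rwa [Nat.add_sub_cancel' hux, hAf x hx] at this
  · rintro t ht ⟨g, hg, hgE⟩
    have hgm : Measurable fun ω => g (Y u ω / s u) := hg.comp (by fun_prop)
    -- a version of the conditional probability is almost everywhere at most one
    have hone : ∀ᵐ x ∂μ.map (fun ω => Y u ω / s u), g x ≤ 1 := by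
      refine ae_le_of_forall_setLIntegral_le_of_sigmaFinite hg fun C hC _ => ?_
      have := Measure.isProbabilityMeasure_map (μ := μ) (f := fun ω => Y u ω / s u) (by fun_prop)
      rw [setLIntegral_map hC hg (by fun_prop), setLIntegral_one,
        Measure.map_apply (by fun_prop) hC, ← hgE]
      · exact measure_mono Set.inter_subset_left
      · exact (hYuF.div_const (s u)) hC
    have hone' : ∀ᵐ ω ∂μ, g (Y u ω / s u) ≤ 1 := 
      ae_of_ae_map (f := fun ω => Y u ω / s u) (by fun_prop) hone
    refine ⟨fun x => 1 - g x, measurable_const.sub hg, fun E hE => ?_⟩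
    have hfin : ∫⁻ ω in E, g (Y u ω / s u) ∂μ ≠ ∞ := by
      rw [← hgE E hE]
      exact measure_ne_top _ _
    rw [lintegral_sub hgm hfin (ae_restrict_of_ae hone'), setLIntegral_one, ← hgE E hE]
    refine ENNReal.eq_sub_of_add_eq (measure_ne_top _ _) ?_
    rw [add_comm, ← Set.sdiff_eq, measure_inter_add_sdiff E (hle t ht)]
  · intro f hdisj hfm hf
    choose g hg hgE using hf
    refine ⟨fun x => ∑' i, g i x, Measurable.tsum hg, fun E hE => ?_⟩
    rw [Set.inter_iUnion, measure_iUnion, lintegral_tsum]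
    · exact tsum_congr fun i => hgE i E hE
    · exact fun i => ((hg i).comp (by fun_prop)).aemeasurable
    · exact fun i j hij => (hdisj hij).mono Set.inter_subset_right Set.inter_subset_right
    · exact fun i => (hle' _ hE).inter (hle _ (hfm i))

end IsMehlerChain

end

/-! ### Absolute regularity -/

lemma ofReal_abs_toReal_sub_le {a b c : ℝ≥0∞} (ha : a ≠ ∞) (hb : b ≠ ∞) (hab : a ≤ b + c)
    (hba : b ≤ a + c) : ENNReal.ofReal |a.toReal - b.toReal| ≤ c := by
  rcases eq_or_ne c ∞ with rfl | hc
  · exact le_top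
  rw [ENNReal.ofReal_le_iff_le_toReal hc, abs_sub_le_iff]
  have h1 := ENNReal.toReal_mono (ENNReal.add_ne_top.2 ⟨hb, hc⟩) hab
  have h2 := ENNReal.toReal_mono (ENNReal.add_ne_top.2 ⟨ha, hc⟩) hba
  rw [ENNReal.toReal_add hb hc] at h1
  rw [ENNReal.toReal_add ha hc] at h2
  constructor <;> linarith

lemma betaTilde_mono {Ω : Type*} {m0 : MeasurableSpace Ω} (μ : Measure Ω)
    {m₁ m₁' m₂ m₂' : MeasurableSpace Ω} (h₁ : m₁ ≤ m₁') (h₂ : m₂ ≤ m₂') :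
    betaTilde μ m₁ m₂ ≤ betaTilde μ m₁' m₂' := by
  unfold betaTilde
  refine iSup_mono fun I => iSup_mono fun J => iSup_mono fun A => iSup_mono fun B => ?_
  refine iSup_mono' fun hA => ⟨⟨fun i => h₁ _ (hA.1 i), hA.2⟩, ?_⟩
  exact iSup_mono' fun hB => ⟨⟨fun i => h₂ _ (hB.1 i), hB.2⟩, le_rfl⟩

namespace IsMehlerChain

variable {Ω : Type*} [MeasurableSpace Ω] {μ : Measure Ω} {Y : ℕ → Ω → ℝ} {s r : ℕ → ℝ}

/-- The versions `g j` of the conditional probabilities of the parts of a partition sum to one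
almost everywhere. -/
lemma ae_sum_eq_one [IsProbabilityMeasure μ] (h : IsMehlerChain μ Y s r) {u : ℕ}
    (hu : 1 ≤ u) {J : ℕ} {B : Fin J → Set Ω} (hB : IsFinitePartition (sigmaField Y (Set.Ici u)) B)
    {g : Fin J → ℝ → ℝ≥0∞} (hg : ∀ j, Measurable (g j))
    (hgE : ∀ j E, MeasurableSet[sigmaField Y (Set.Iic u)] E →
      μ (E ∩ B j) = ∫⁻ ω in E, g j (Y u ω / s u) ∂μ) :
    ∀ᵐ y ∂γ, ∑ j, g j y = 1 := by
  have hle := sigmaField_le h.measurable (Set.Ici u)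
  have hYu := h.measurable u
  refine ae_eq_of_forall_setLIntegral_eq_of_sigmaFinite (Finset.measurable_sum _ fun j _ => hg j)
    measurable_const fun C hC _ => ?_
  have hCF : MeasurableSet[sigmaField Y (Set.Iic u)] ((fun ω => Y u ω / s u) ⁻¹' C) :=
    (measurable_sigmaField Y (Set.mem_Iic.2 (le_refl u))).div_const (s u) hC
  have hCm : MeasurableSet ((fun ω => Y u ω / s u) ⁻¹' C) := hC.preimage (by fun_prop)
  rw [setLIntegral_one, lintegral_finsetSum _ fun j _ => hg j, ← h.map_eq u hu,
    Measure.map_apply (by fun_prop) hC]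
  calc ∑ j, ∫⁻ y in C, g j y ∂μ.map (fun ω => Y u ω / s u)
      = ∑ j, μ ((fun ω => Y u ω / s u) ⁻¹' C ∩ B j) := by
        refine Finset.sum_congr rfl fun j _ => ?_
        rw [setLIntegral_map hC (hg j) (by fun_prop), hgE j _ hCF]
    _ = μ ((fun ω => Y u ω / s u) ⁻¹' C) := by
        rw [← tsum_fintype (L := .unconditional _), ← measure_iUnion, ← Set.inter_iUnion, hB.2.2,
          Set.inter_univ]
        · exact fun i j hij =>
            (hB.2.1 i j hij).mono Set.inter_subset_right Set.inter_subset_right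
        · exact fun j => hCm.inter (hle _ (hB.1 j))

/-- Dependence of one past event `A` and one future event `B`, where `g` is the conditional
probability of `B` as a function of the state at time `t + k`. -/
lemma ofReal_abs_measure_inter_sub_le [IsProbabilityMeasure μ] (h : IsMehlerChain μ Y s r) {t : ℕ}
    (ht : 1 ≤ t) (k : ℕ) {R : ℝ} (hR : ∏ i ∈ Finset.range k, r (t + i) = R) (hr : R ^ 2 < 1)
    {A B : Set Ω} (hA : MeasurableSet[sigmaField Y (Set.Iic t)] A) {g : ℝ → ℝ≥0∞}
    (hg : Measurable g) (hgE : ∀ E, MeasurableSet[sigmaField Y (Set.Iic (t + k))] E →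
      μ (E ∩ B) = ∫⁻ ω in E, g (Y (t + k) ω / s (t + k)) ∂μ) :
    ENNReal.ofReal |μ.real (A ∩ B) - μ.real A * μ.real B| ≤
      ∫⁻ ω in A, ∫⁻ y, g y * ENNReal.ofReal |mehlerDensity R (Y t ω / s t) y - 1| ∂γ ∂μ := by
  have hu : 1 ≤ t + k := by omega
  have hYt := h.measurable t
  have hYu := h.measurable (t + k)
  have hgw : Measurable fun x => ∫⁻ y, g y * ENNReal.ofReal |mehlerDensity R x y - 1| ∂γ :=
    Measurable.lintegral_prod_right'
      (f := fun p : ℝ × ℝ => g p.2 * ENNReal.ofReal |mehlerDensity R p.1 p.2 - 1|)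
      ((hg.comp measurable_snd).mul
        ((measurable_mehlerDensity R).sub_const 1).abs.ennreal_ofReal)
  have hjoint : μ (A ∩ B) = ∫⁻ ω in A,
      ∫⁻ y, g y * ENNReal.ofReal (mehlerDensity R (Y t ω / s t) y) ∂γ ∂μ := by
    rw [hgE _ (sigmaField_mono Y (Set.Iic_subset_Iic.2 (Nat.le_add_right t k)) _ hA),
      h.setLIntegral_add ht k hA hg, hR]
    exact lintegral_congr fun ω => mehler_eq_lintegral_mehlerDensity hr hg _
  have hprod : μ A * μ B = ∫⁻ ω in A, ∫⁻ y, g y ∂γ ∂μ := by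
    have h1 := hgE Set.univ MeasurableSet.univ
    rw [Set.univ_inter, Measure.restrict_univ] at h1
    rw [lintegral_const, Measure.restrict_apply_univ, mul_comm, h1, ← h.map_eq _ hu,
      lintegral_map hg (by fun_prop)]
  have hreal : μ.real A * μ.real B = (μ A * μ B).toReal := by
    rw [ENNReal.toReal_mul]
    rfl
  rw [hreal, measureReal_def]
  have hgwm : Measurable fun ω =>
      ∫⁻ y, g y * ENNReal.ofReal |mehlerDensity R (Y t ω / s t) y - 1| ∂γ :=
    hgw.comp (hYt.div_const (s t))
  refine ofReal_abs_toReal_sub_le (measure_ne_top _ _)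
    (ENNReal.mul_ne_top (measure_ne_top _ _) (measure_ne_top _ _)) ?_ ?_
  · rw [hjoint, hprod, ← lintegral_add_right _ hgwm]
    refine lintegral_mono fun ω => ?_
    rw [← lintegral_add_left hg]
    refine lintegral_mono fun y => ?_
    rw [← mul_one_add]
    gcongr
    rw [← ENNReal.ofReal_one, ← ENNReal.ofReal_add zero_le_one (abs_nonneg _)]
    refine ENNReal.ofReal_le_ofReal ?_
    linarith [le_abs_self (mehlerDensity R (Y t ω / s t) y - 1)]
  · rw [hjoint, hprod, ← lintegral_add_right _ hgwm]
    refine lintegral_mono fun ω => ?_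
    have hgy : Measurable fun y => g y * ENNReal.ofReal |mehlerDensity R (Y t ω / s t) y - 1| :=
      hg.mul ((measurable_mehlerDensity_right R _).sub_const 1).abs.ennreal_ofReal
    rw [← lintegral_add_right _ hgy]
    refine lintegral_mono fun y => ?_
    rw [← mul_add]
    refine le_mul_of_one_le_right' ?_
    rw [← ENNReal.ofReal_one,
      ← ENNReal.ofReal_add (mehlerDensity_nonneg _ _ _) (abs_nonneg _)]
    refine ENNReal.ofReal_le_ofReal ?_
    linarith [neg_abs_le (mehlerDensity R (Y t ω / s t) y - 1)]

/-- The coefficient of absolute regularity between the past up to `t` and the future from `t + k`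
is controlled by the bivariate normal law with correlation `∏ r`. -/
lemma betaTilde_le [IsProbabilityMeasure μ] (h : IsMehlerChain μ Y s r) {t : ℕ} (ht : 1 ≤ t)
    (k : ℕ) (hr : (∏ i ∈ Finset.range k, r (t + i)) ^ 2 < 1) :
    betaTilde μ (sigmaField Y (Set.Iic t)) (sigmaField Y (Set.Ici (t + k))) ≤
      mehlerDist (∏ i ∈ Finset.range k, r (t + i)) := by
  set R := ∏ i ∈ Finset.range k, r (t + i) with hR
  refine iSup_le fun I => iSup_le fun J => iSup_le fun A => iSup_le fun B =>
    iSup_le fun hA => iSup_le fun hB => ?_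
  have hu : 1 ≤ t + k := by omega
  have hYt := h.measurable t
  have hleA := sigmaField_le h.measurable (Set.Iic t)
  choose g hg hgE using fun j => h.exists_setLIntegral_eq hu (hB.1 j)
  have hsum := h.ae_sum_eq_one hu hB hg hgE
  set w : ℝ → ℝ → ℝ≥0∞ := fun x y => ENNReal.ofReal |mehlerDensity R x y - 1| with hw
  have hwm : Measurable fun p : ℝ × ℝ => w p.1 p.2 :=
    ((measurable_mehlerDensity R).sub_const 1).abs.ennreal_ofReal
  have hwr : ∀ x, Measurable (w x) := fun x =>
    ((measurable_mehlerDensity_right R x).sub_const 1).abs.ennreal_ofReal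
  have hgw : ∀ j, Measurable fun x => ∫⁻ y, g j y * w x y ∂γ := fun j =>
    Measurable.lintegral_prod_right' (f := fun p : ℝ × ℝ => g j p.2 * w p.1 p.2)
      (((hg j).comp measurable_snd).mul hwm)
  calc ENNReal.ofReal
        (1 / 2 * ∑ i, ∑ j, |μ.real (A i ∩ B j) - μ.real (A i) * μ.real (B j)|)
      ≤ ENNReal.ofReal (∑ i, ∑ j, |μ.real (A i ∩ B j) - μ.real (A i) * μ.real (B j)|) := by
        refine ENNReal.ofReal_le_ofReal ?_
        have : 0 ≤ ∑ i, ∑ j, |μ.real (A i ∩ B j) - μ.real (A i) * μ.real (B j)| := by positivity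
        linarith
    _ = ∑ i, ∑ j, ENNReal.ofReal |μ.real (A i ∩ B j) - μ.real (A i) * μ.real (B j)| := by
        rw [ENNReal.ofReal_sum_of_nonneg fun i _ => by positivity]
        exact Finset.sum_congr rfl fun i _ =>
          ENNReal.ofReal_sum_of_nonneg fun j _ => abs_nonneg _
    _ ≤ ∑ i, ∑ j, ∫⁻ ω in A i, ∫⁻ y, g j y * w (Y t ω / s t) y ∂γ ∂μ :=
        Finset.sum_le_sum fun i _ => Finset.sum_le_sum fun j _ =>
          h.ofReal_abs_measure_inter_sub_le ht k hR.symm hr (hA.1 i) (hg j) (hgE j)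
    _ = ∑ i, ∫⁻ ω in A i, ∫⁻ y, w (Y t ω / s t) y ∂γ ∂μ := by
        refine Finset.sum_congr rfl fun i _ => ?_
        have hgω : ∀ j, Measurable fun ω => ∫⁻ y, g j y * w (Y t ω / s t) y ∂γ :=
          fun j => (hgw j).comp (hYt.div_const (s t))
        rw [← lintegral_finsetSum _ fun j _ => hgω j]
        refine lintegral_congr fun ω => ?_
        have hgy : ∀ j, Measurable fun y => g j y * w (Y t ω / s t) y :=
          fun j => (hg j).mul (hwr _)
        rw [← lintegral_finsetSum _ fun j _ => hgy j]
        refine lintegral_congr_ae (hsum.mono fun y hy => ?_)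
        simp only [← Finset.sum_mul, hy, one_mul]
    _ = ∫⁻ ω, ∫⁻ y, w (Y t ω / s t) y ∂γ ∂μ := by
        rw [← tsum_fintype (L := .unconditional _),
          ← lintegral_iUnion (fun i => hleA _ (hA.1 i)) (fun i j hij => hA.2.1 i j hij), hA.2.2,
          Measure.restrict_univ]
    _ = mehlerDist R := by
        rw [mehlerDist, ← h.map_eq t ht]
        exact (lintegral_map hwm.lintegral_prod_right' (by fun_prop)).symm

/-- A Mehler chain whose one-step correlations are bounded away from `1` is absolutely regular. -/
lemma isBetaMixing [IsProbabilityMeasure μ] (h : IsMehlerChain μ Y s r) {q : ℝ} (hq0 : 0 ≤ q)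
    (hq : q < 1) (hr : ∀ t, |r t| ≤ q) : IsBetaMixing μ Y := by
  refine ENNReal.tendsto_atTop_zero.2 fun ε hε => ?_
  have hev : ∀ᶠ R in 𝓝 (0 : ℝ), mehlerDist R ≤ ε :=
    (tendsto_mehlerDist.eventually_lt_const hε).mono fun _ => le_of_lt
  obtain ⟨δ, hδ, hδε⟩ := Metric.eventually_nhds_iff.1 hev
  -- `min δ 1` rather than `δ`: the density needs a correlation of modulus less than one
  obtain ⟨N, hN⟩ := exists_pow_lt_of_lt_one (lt_min hδ one_pos) hq
  have hbound : ∀ t k, 1 ≤ t → N ≤ k →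
      betaTilde μ (sigmaField Y (Set.Iic t)) (sigmaField Y (Set.Ici (t + k))) ≤ ε := by
    intro t k ht hk
    have hR : |∏ i ∈ Finset.range k, r (t + i)| < min δ 1 := by
      refine lt_of_le_of_lt ?_ hN
      rw [Finset.abs_prod]
      calc ∏ i ∈ Finset.range k, |r (t + i)| ≤ ∏ _i ∈ Finset.range k, q :=
            Finset.prod_le_prod (fun _ _ => abs_nonneg _) fun i _ => hr _
        _ = q ^ k := by simp
        _ ≤ q ^ N := pow_le_pow_of_le_one hq0 hq.le hk
    refine (h.betaTilde_le ht k ?_).trans (hδε ?_)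
    · exact (sq_lt_one_iff_abs_lt_one _).2 (hR.trans_le (min_le_right _ _))
    · rw [Real.dist_eq, sub_zero]
      exact hR.trans_le (min_le_left _ _)
  refine ⟨N + 1, fun k hk => iSup_le fun t => ?_⟩
  rcases Nat.eq_zero_or_pos t with rfl | ht
  · -- enlarge the past to include time `1`, at the price of one step of the gap
    refine (betaTilde_mono μ (sigmaField_mono Y (Set.Iic_subset_Iic.2 zero_le_one))
      (sigmaField_mono Y (Set.Ici_subset_Ici.2 ?_))).trans (hbound 1 (k - 1) le_rfl (by omega))
    simp only [Nat.cast_id]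
    omega
  · exact hbound t k ht (by omega)

end IsMehlerChain

end CopulaMarkov


theorem corollary1 {Ω : Type*} [MeasurableSpace Ω] (μ : Measure Ω) [IsProbabilityMeasure μ]
    (σ ρ : ℝ) (hσ : 0 < σ) (hρ : ρ ∈ Set.Ioo (-1 : ℝ) 0)
    (Y ξ : ℕ → Ω → ℝ)
    (hMarkov : CopulaMarkov.IsMarkovProcess μ Y)
    (hY0 : ∀ᵐ ω ∂μ, Y 0 ω = 0)
    (hY : ∀ t : ℕ, 1 ≤ t → ∀ᵐ ω ∂μ, Y t ω = Y (t - 1) ω + ξ t ω)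
    (hξ : ∀ t : ℕ, 1 ≤ t → HasLaw (ξ t) (gaussianReal 0 (Real.toNNReal (σ ^ 2))) μ)
    (hC : ∀ t : ℕ, 1 ≤ t →
      CopulaMarkov.HasCopula μ (Y (t - 1)) (ξ t) (CopulaMarkov.gaussianCopula ρ)) :
    CopulaMarkov.IsBetaMixing μ Y := by
  open CopulaMarkov in
  obtain ⟨q, hq0, hq1, hq⟩ := exists_abs_stepCorr_le hσ hρ
  have hmeas := hMarkov.1
  have hpos : ∀ t, 1 ≤ t → stdDev σ ρ t ≠ 0 := by
    intro t ht
    obtain ⟨n, rfl⟩ := Nat.exists_eq_add_of_le' ht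
    exact (stdDev_succ_pos hσ hρ n).ne'
  have hpair : ∀ t, 1 ≤ t →
      μ.map (fun ω => (Y t ω / stdDev σ ρ t, Y (t + 1) ω / stdDev σ ρ (t + 1))) =
        bivariateNormal (stepCorr σ ρ t) := by
    intro t ht
    obtain ⟨n, rfl⟩ := Nat.exists_eq_add_of_le' ht
    exact map_standardised_pair hσ hρ hmeas hY0 hY hξ hC n
  have hchain : IsMehlerChain μ Y (stdDev σ ρ) (stepCorr σ ρ) :=
    { measurable := hmeas
      scale_ne_zero := hpos
      corr_sq_le_one := fun t _ => by
        rw [sq_le_one_iff_abs_le_one]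
        exact (hq t).trans hq1.le
      map_eq := fun t ht => by
        have := map_fst_of_map_prodMk ((hmeas t).div_const (stdDev σ ρ t))
          ((hmeas (t + 1)).div_const (stdDev σ ρ (t + 1))) (hpair t ht)
        exact this
      setLIntegral_succ := fun t ht E hE f hf =>
        hMarkov.setLIntegral_succ (hpos t ht) (hpair t ht) hE hf }
  exact hchain.isBetaMixing hq0 hq1 hq
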